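/- **Theorem (generic convex weak$^*$-compact sets).** Let $\mathbb K\in\{\mathbb R,\mathbb C\}$, let $X$ be a separable topological $\mathbb K$-vector space and let $X^*$ be its topological dual, endowed with the weak$^*$ topology. Assume that $X^*$ separates the points of $X$ (in particular $X$ is Hausdorff). Endow the set $\mathbf F(X^*)$ of all nonempty weak$^*$-closed subsets of $X^*$ with the *weak$^*$-Hausdorff hypertopology*, i.e. the topology generated by the family of pseudometrics, $A\in X$, $$d_H^{(A)}(F,\tilde F)=\max\Big\{\sup_{\sigma\in F}\inf_{\tilde\sigma\in\tilde F}|(\sigma-\tilde\sigma)(A)|,\ \sup_{\tilde\sigma\in\tilde F}\inf_{\sigma\in F}|(\sigma-\tilde\sigma)(A)|\Big\}\in[0,\infty],$$ and endow its subsets with the subspace topology. For a $0$-neighbourhood $U\subseteq X$ let $U^\circ=\{\sigma\in X^*:|\sigma(A)|\le 1\text{ for all }A\in U\}$ be its absolute polar, and set $$\mathbf{CU}_U(X^*)=\{K\in\mathbf F(X^*): K\text{ is convex and }K\subseteq U^\circ\},\qquad \mathcal D_U=\{K\in\mathbf{CU}_U(X^*):K=\overline{\mathcal E(K)}\},$$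 where $\mathcal E(K)$ is the set of extreme points of $K$ and the bar is the weak$^*$ closure. Let $\mathbf{CU}(X^*)=\bigcup_U\mathbf{CU}_U(X^*)$ and $\mathcal D=\bigcup_U\mathcal D_U$, the unions being over all $0$-neighbourhoods $U$ of $X$. Say that a $0$-neighbourhood $U$ satisfies condition $(\ast)$ if there is a sequence $(\sigma_n)_{n\in\mathbb N}$ of linearly independent elements of $X^*$ with $\sup_{A\in U}|\sigma_n(A)|<\infty$ for every $n\in\mathbb N$. Call $X$ a *Gateaux-differentiability space* if every continuous convex real-valued function defined on a nonempty open convex subset of $X$ is Gateaux-differentiable at each point of some dense subset of its domain (Gateaux-differentiable at a point means: the two-sided directional derivatives in all directions exist and form a continuous real-linear functional of the direction). (i) If $X$ is a Gateaux-differentiability space and $U$ is a $0$-neighbourhood satisfying $(\ast)$, then $\mathcal D_U$ is a dense $G_\delta$ subset of $\mathbf{CU}_U(X^*)$. (ii) If $X$ is completely metrizable and some $0$-neighbourhood of $X$ satisfies $(\ast)$, then $\mathcal D$ is a dense $G_\delta$ subset of $\mathbf{CU}(X^*)$. -/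

import Mathlib

open Set Topology
open scoped ENNReal

namespace WeakStarHyper

section Gateaux

variable {X : Type*} [AddCommGroup X] [Module ℝ X] [TopologicalSpace X]

/-- `f` is Gateaux-differentiable at `x`: every two-sided directional derivative of `f` at `x`
exists, and together they form a continuous real-linear functional. -/
def GateauxDifferentiableAt (f : X → ℝ) (x : X) : Prop :=
  ∃ φ : X →L[ℝ] ℝ, ∀ v : X, HasLineDerivAt ℝ f (φ v) x v

variable (X) in
/-- Every continuous convex real-valued function whose domain `C` is a nonempty open convex
set is Gateaux-differentiable on a dense subset of `C`. (Values of `f` outside the open set `C`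
play no role.) -/
def IsGateauxDifferentiabilitySpace : Prop :=
  ∀ (C : Set X) (f : X → ℝ), IsOpen C → C.Nonempty → ConvexOn ℝ C f → ContinuousOn f C →
    C ⊆ closure {x ∈ C | GateauxDifferentiableAt f x}

end Gateaux

section Hyperspace

variable (𝕜 : Type*) [RCLike 𝕜] (X : Type*) [AddCommGroup X] [Module 𝕜 X] [TopologicalSpace X]

/-- The hyperspace of all nonempty weak-star closed subsets of the dual space. -/
def Hyperspace : Type _ := {F : Set (WeakDual 𝕜 X) // F.Nonempty ∧ IsClosed F}

variable {𝕜 X}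

/-- The underlying subset of the dual space. -/
def Hyperspace.carrier (F : Hyperspace 𝕜 X) : Set (WeakDual 𝕜 X) := F.1

/-- The Hausdorff pseudometric on the hyperspace attached to a vector `A`, with values in
`[0, ∞]`. -/
noncomputable def hausdorffPseudo (A : X) (F G : Hyperspace 𝕜 X) : ℝ≥0∞ :=
  max (⨆ σ ∈ F.carrier, ⨅ τ ∈ G.carrier, ‖σ A - τ A‖ₑ)
    (⨆ τ ∈ G.carrier, ⨅ σ ∈ F.carrier, ‖σ A - τ A‖ₑ)

/-- It is the usual Hausdorff distance of the images under evaluation at `A`. -/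
theorem hausdorffPseudo_eq (A : X) (F G : Hyperspace 𝕜 X) :
    hausdorffPseudo A F G =
      Metric.hausdorffEDist ((fun σ : WeakDual 𝕜 X => σ A) '' F.carrier)
        ((fun σ : WeakDual 𝕜 X => σ A) '' G.carrier) := by
  simp only [hausdorffPseudo, Metric.hausdorffEDist_def, Metric.infEDist, iSup_image, iInf_image,
    ← edist_eq_enorm_sub]
  congr 1
  simp only [edist_comm]

/-- The extended pseudometric space structure given by `hausdorffPseudo A`. -/
noncomputable abbrev hausdorffPseudoEMetric (A : X) : PseudoEMetricSpace (Hyperspace 𝕜 X) where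
  edist := hausdorffPseudo A
  edist_self F := by
    rw [hausdorffPseudo_eq, Metric.hausdorffEDist_self]
  edist_comm F G := by
    rw [hausdorffPseudo_eq, hausdorffPseudo_eq, Metric.hausdorffEDist_comm]
  edist_triangle F G H := by
    rw [hausdorffPseudo_eq, hausdorffPseudo_eq, hausdorffPseudo_eq]
    exact Metric.hausdorffEDist_triangle

/-- The weak-star Hausdorff hypertopology: the topology generated by all the pseudometrics
`hausdorffPseudo A`, where `A` runs over the vectors of `X`. -/
noncomputable instance : TopologicalSpace (Hyperspace 𝕜 X) :=
  ⨅ A : X, (hausdorffPseudoEMetric (𝕜 := 𝕜) A).toUniformSpace.toTopologicalSpace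

/-- There are infinitely many linearly independent continuous functionals, each of them bounded
on `U`. -/
def InfiniteDimensionalPolar (𝕜 : Type*) [RCLike 𝕜] {X : Type*} [AddCommGroup X] [Module 𝕜 X]
    [TopologicalSpace X] (U : Set X) : Prop :=
  ∃ σ : ℕ → WeakDual 𝕜 X, LinearIndependent 𝕜 σ ∧
    ∀ n, BddAbove ((fun A : X => ‖σ n A‖) '' U)

/-- Nonempty convex weak-star closed subsets of the absolute polar of `U`. -/
def CUsub (𝕜 : Type*) [RCLike 𝕜] {X : Type*} [AddCommGroup X] [Module 𝕜 X]
    [TopologicalSpace X] (U : Set X) : Set (Hyperspace 𝕜 X) :=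
  {F | Convex ℝ F.carrier ∧ F.carrier ⊆ WeakDual.polar 𝕜 U}

/-- Members of `CUsub 𝕜 U` whose extreme points are weak-star dense in them. -/
def Dsub (𝕜 : Type*) [RCLike 𝕜] {X : Type*} [AddCommGroup X] [Module 𝕜 X]
    [TopologicalSpace X] (U : Set X) : Set (Hyperspace 𝕜 X) :=
  {F | F ∈ CUsub 𝕜 U ∧ F.carrier = closure (F.carrier.extremePoints ℝ)}

variable (𝕜 X)

/-- Nonempty convex weak-star closed subsets of the absolute polar of some `0`-neighbourhood. -/
def CU : Set (Hyperspace 𝕜 X) := ⋃ U ∈ 𝓝 (0 : X), CUsub 𝕜 U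

/-- Members of `CU 𝕜 X` whose extreme points are weak-star dense in them. -/
def D : Set (Hyperspace 𝕜 X) := ⋃ U ∈ 𝓝 (0 : X), Dsub 𝕜 U

end Hyperspace

end WeakStarHyper

/-! For a `0`-neighbourhood `U` the polar is weak-star compact (`isCompact_polar`) and, `X` being
separable, second countable. The space `CUsub 𝕜 U` is compact (`isCompact_CUsub`) and Hausdorff,
hence Baire. Countably many pairs, a compact Q inside an open V, suffice to test density of extreme
points: K lies in `Dsub 𝕜 U` iff for every pair K misses Q or has an extreme point in V
(`Dsub_eq_biInter_avoidOrExtreme`). Each condition is open: half-spaces keep nearby sets off Q, and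
slices carry extreme points in V over to nearby sets (`eventually_extremePoints_inter_nonempty`).
Each is dense: K is approximated by a polytope with a vertex in V outside the span of the other
vertices (`exists_polytope_nearby`), which exists because infinitely many independent functionals
are bounded on `U`.

For the union over all `U`, density follows by shrinking `U`. With a countable base at `0`, `CU` is
a countable union of compact pieces; within a piece the failure of one condition is a compact set,
hence closed in the Hausdorff space `CU`, and `D` is what remains after removing countably many of
these. -/

namespace WeakStarHyper

open Filter

/-! ### Weak-star duality, separation and Banach–Alaoglu -/

section WeakDualBasics

variable {𝕜 : Type*} [RCLike 𝕜] {X : Type*} [AddCommGroup X] [Module 𝕜 X] [TopologicalSpace X]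

instance weakDual_isScalarTower : IsScalarTower ℝ 𝕜 (WeakDual 𝕜 X) where
  smul_assoc r z σ := DFunLike.ext _ _ fun A => smul_assoc r z (σ A)

/-- Evaluation at `A` as a real-linear map. -/
noncomputable def evalReal (A : X) : WeakDual 𝕜 X →ₗ[ℝ] 𝕜 where
  toFun σ := σ A
  map_add' _ _ := rfl
  map_smul' _ _ := rfl

instance weakDual_locallyConvexSpace : LocallyConvexSpace ℝ (WeakDual 𝕜 X) := by
  exact LocallyConvexSpace.induced (LinearMap.pi fun A : X => evalReal (𝕜 := 𝕜) A)

theorem tendsto_weakDual_iff {α : Type*} {l : Filter α} {g : α → WeakDual 𝕜 X}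
    {σ : WeakDual 𝕜 X} :
    Tendsto g l (𝓝 σ) ↔ ∀ A : X, Tendsto (fun i => g i A) l (𝓝 (σ A)) := by
  rw [← tendsto_pi_nhds]
  exact (WeakBilin.isEmbedding (B := topDualPairing 𝕜 X)
    ContinuousLinearMap.coe_injective).tendsto_nhds_iff

/-- Every weak-star continuous functional is the evaluation at a vector. -/
theorem exists_forall_eq_eval (f : WeakDual 𝕜 X →L[𝕜] 𝕜) :
    ∃ A : X, ∀ τ : WeakDual 𝕜 X, f τ = τ A := by
  obtain ⟨A, hA⟩ := LinearMap.dualEmbedding_surjective (topDualPairing 𝕜 X) f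
  exact ⟨A, fun τ => (DFunLike.congr_fun hA τ).symm⟩

/-- A real functional is the real part of a 𝕜-linear one, so real Hahn–Banach separation can be
phrased with vectors of `X`. -/
theorem exists_forall_eq_re_eval (f : WeakDual 𝕜 X →L[ℝ] ℝ) :
    ∃ A : X, ∀ τ : WeakDual 𝕜 X, f τ = RCLike.re (τ A) := by
  obtain ⟨A, hA⟩ :=
    exists_forall_eq_eval (StrongDual.extendRCLike (𝕜 := 𝕜) (F := WeakDual 𝕜 X) f)
  refine ⟨A, fun τ => ?_⟩
  rw [← hA, StrongDual.re_extendRCLike_apply]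

/-- Convexity for the scalar multiplication that comes from the real module structure. -/
theorem convex_iff_convex_module {K : Set (WeakDual 𝕜 X)} :
    Convex ℝ K ↔ @Convex ℝ (WeakDual 𝕜 X) _ _ AddCommGroup.toAddCommMonoid
      (WeakDual.instModule' ℝ).toSMul K := Iff.rfl

theorem extremePoints_eq_extremePoints_module (K : Set (WeakDual 𝕜 X)) :
    K.extremePoints ℝ = @Set.extremePoints ℝ (WeakDual 𝕜 X) _ _ AddCommGroup.toAddCommMonoid
      (WeakDual.instModule' ℝ).toSMul K := rfl

/-- A point outside a weak-star closed convex set is separated from it by a vector. -/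
theorem exists_separating_vector {K : Set (WeakDual 𝕜 X)} (hK : Convex ℝ K) (hKc : IsClosed K)
    {σ : WeakDual 𝕜 X} (hσ : σ ∉ K) :
    ∃ (A : X) (c : ℝ), (∀ τ ∈ K, RCLike.re (τ A) < c) ∧ c < RCLike.re (σ A) := by
  obtain ⟨f, c, h1, h2⟩ := geometric_hahn_banach_closed_point (E := WeakDual 𝕜 X)
    (convex_iff_convex_module.1 hK) hKc hσ
  obtain ⟨A, hf⟩ := exists_forall_eq_re_eval f
  exact ⟨A, c, fun τ hτ => hf τ ▸ h1 τ hτ, hf σ ▸ h2⟩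

theorem continuous_re_eval (A : X) : Continuous fun σ : WeakDual 𝕜 X => RCLike.re (σ A) :=
  RCLike.continuous_re.comp (WeakDual.eval_continuous A)

/-- Evaluation on a countable dense set is continuous and injective, hence on a compact set an
embedding into a countable power of `𝕜`. -/
theorem secondCountableTopology_of_isCompact [TopologicalSpace.SeparableSpace X]
    {Q : Set (WeakDual 𝕜 X)} (hQ : IsCompact Q) : SecondCountableTopology Q := by
  obtain ⟨s, hs, hd⟩ := TopologicalSpace.exists_countable_dense X
  have := isCompact_iff_compactSpace.1 hQ
  have : Countable s := hs.to_subtype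
  let g : Q → s → 𝕜 := fun σ A => σ.1 A
  have hg : Continuous g := continuous_pi fun A =>
    (WeakDual.eval_continuous A.1).comp continuous_subtype_val
  have hinj : Function.Injective g := by
    intro σ τ h
    refine Subtype.ext (DFunLike.coe_injective ?_)
    exact Continuous.ext_on hd (map_continuous σ.1) (map_continuous τ.1)
      fun A hA => congrFun h ⟨A, hA⟩
  exact (hg.isClosedEmbedding hinj).isEmbedding.secondCountableTopology

variable [IsTopologicalAddGroup X] [ContinuousSMul 𝕜 X]

/-- The Banach–Alaoglu theorem for topological vector spaces. -/
theorem isCompact_polar {U : Set X} (hU : U ∈ 𝓝 (0 : X)) : IsCompact (WeakDual.polar 𝕜 U) := by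
  rw [isCompact_iff_ultrafilter_le_nhds]
  intro f hf
  have hf' : ∀ᶠ σ in (f : Filter (WeakDual 𝕜 X)), σ ∈ WeakDual.polar 𝕜 U := le_principal_iff.1 hf
  have hlim : ∀ A : X, ∃ z : 𝕜, Tendsto (fun σ : WeakDual 𝕜 X => σ A) f (𝓝 z) := by
    intro A
    -- `U` absorbs `A`, which bounds all values at `A` of functionals in the polar by `‖c‖`.
    obtain ⟨c, hc⟩ := (absorbent_nhds_zero (𝕜 := 𝕜) hU A).exists
    obtain ⟨u, hu, rfl⟩ := hc (mem_singleton A)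
    obtain ⟨z, -, hz⟩ := (isCompact_closedBall (0 : 𝕜) ‖c‖).ultrafilter_le_nhds
      (f.map fun σ : WeakDual 𝕜 X => σ (c • u)) (by
        rw [le_principal_iff, Ultrafilter.coe_map, mem_map]
        filter_upwards [hf'] with σ hσ
        have h1 : ‖σ u‖ ≤ 1 := hσ u hu
        simpa [map_smul] using mul_le_of_le_one_right (norm_nonneg c) h1)
    exact ⟨z, hz⟩
  choose ℓ hℓ using hlim
  have hb : ∀ A ∈ U, ‖ℓ A‖ ≤ 1 := fun A hA =>
    le_of_tendsto (hℓ A).norm (hf'.mono fun σ hσ => hσ A hA)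
  let L : X →ₗ[𝕜] 𝕜 :=
    { toFun := ℓ
      map_add' := fun A B => tendsto_nhds_unique (hℓ (A + B)) <| by
        simpa using (hℓ A).add (hℓ B)
      map_smul' := fun c A => tendsto_nhds_unique (hℓ (c • A)) <| by
        simpa using (hℓ A).const_mul c }
  have hbdd : Bornology.IsBounded (L '' U) := by
    refine (isBounded_iff_forall_norm_le).2 ⟨1, ?_⟩
    rintro _ ⟨A, hA, rfl⟩
    exact hb A hA
  let Lc : WeakDual 𝕜 X := StrongDual.toWeakDual (L.clmOfExistsBoundedImage
    ⟨U, hU, NormedSpace.isVonNBounded_of_isBounded 𝕜 hbdd⟩)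
  exact ⟨Lc, fun A hA => hb A hA, tendsto_weakDual_iff.2 hℓ⟩

end WeakDualBasics

/-! ### Neighbourhoods in the hypertopology -/

section HyperBasics

variable {𝕜 : Type*} [RCLike 𝕜] {X : Type*} [AddCommGroup X] [Module 𝕜 X] [TopologicalSpace X]

theorem nhds_hyperspace (K : Hyperspace 𝕜 X) :
    𝓝 K = ⨅ A : X, ⨅ ε : ℝ≥0∞, ⨅ _ : 0 < ε, 𝓟 {L | hausdorffPseudo A L K < ε} := by
  rw [nhds_iInf]
  refine iInf_congr fun A => ?_
  let := hausdorffPseudoEMetric (𝕜 := 𝕜) A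
  exact EMetric.nhds_eq (x := K)

theorem eventually_hausdorffPseudo_lt (K : Hyperspace 𝕜 X) (A : X) {ε : ℝ≥0∞} (hε : 0 < ε) :
    ∀ᶠ L in 𝓝 K, hausdorffPseudo A L K < ε := by
  rw [nhds_hyperspace]
  exact mem_iInf_of_mem A (mem_iInf_of_mem ε (mem_iInf_of_mem hε (mem_principal_self _)))

theorem le_nhds_hyperspace_iff {l : Filter (Hyperspace 𝕜 X)} {K : Hyperspace 𝕜 X} :
    l ≤ 𝓝 K ↔ ∀ A : X, ∀ ε : ℝ, 0 < ε → ∀ᶠ L in l,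
      (∀ σ ∈ L.carrier, ∃ τ ∈ K.carrier, ‖σ A - τ A‖ < ε) ∧
      ∀ τ ∈ K.carrier, ∃ σ ∈ L.carrier, ‖σ A - τ A‖ < ε := by
  have key : ∀ (z : 𝕜) (ε : ℝ), ‖z‖ₑ < ENNReal.ofReal ε ↔ ‖z‖ < ε := fun z ε => by
    rw [← ofReal_norm]
    constructor
    · intro h; exact (ENNReal.ofReal_lt_ofReal_iff_of_nonneg (norm_nonneg _)).1 h
    · intro h; exact (ENNReal.ofReal_lt_ofReal_iff_of_nonneg (norm_nonneg _)).2 h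
  constructor
  · intro h A ε hε
    filter_upwards [h (eventually_hausdorffPseudo_lt K A (ENNReal.ofReal_pos.2 hε))] with L hL
    rw [hausdorffPseudo, max_lt_iff] at hL
    constructor
    · intro σ hσ
      have := lt_of_le_of_lt (le_iSup₂ (f := fun σ (_ : σ ∈ L.carrier) =>
        ⨅ τ ∈ K.carrier, ‖σ A - τ A‖ₑ) σ hσ) hL.1
      simpa only [iInf_lt_iff, key, exists_prop] using this
    · intro τ hτ
      have := lt_of_le_of_lt (le_iSup₂ (f := fun τ (_ : τ ∈ K.carrier) =>
        ⨅ σ ∈ L.carrier, ‖σ A - τ A‖ₑ) τ hτ) hL.2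
      simpa only [iInf_lt_iff, key, exists_prop] using this
  · intro h
    rw [nhds_hyperspace]
    refine le_iInf fun A => le_iInf fun ε => le_iInf fun hε => le_principal_iff.2 ?_
    -- Pointwise strict bounds survive a supremum only as `≤ δ`, so `δ` is taken strictly below `ε`.
    obtain ⟨δ, hδ, hδε⟩ := ENNReal.lt_iff_exists_real_btwn.1 hε
    obtain ⟨hδ0, hδε⟩ := hδε
    have hδ0 : 0 < δ := ENNReal.ofReal_pos.1 hδ0
    filter_upwards [h A δ hδ0] with L hL
    refine lt_of_le_of_lt (max_le ?_ ?_) hδε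
    · refine iSup₂_le fun σ hσ => ?_
      obtain ⟨τ, hτ, hd⟩ := hL.1 σ hσ
      exact (iInf₂_le τ hτ).trans ((key _ _).2 hd).le
    · refine iSup₂_le fun τ hτ => ?_
      obtain ⟨σ, hσ, hd⟩ := hL.2 τ hτ
      exact (iInf₂_le σ hσ).trans ((key _ _).2 hd).le

theorem eventually_exists_lt_re {K : Hyperspace 𝕜 X} {A : X} {c : ℝ} {σ : WeakDual 𝕜 X}
    (hσ : σ ∈ K.carrier) (hc : c < RCLike.re (σ A)) :
    ∀ᶠ L in 𝓝 K, ∃ τ ∈ L.carrier, c < RCLike.re (τ A) := by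
  filter_upwards [le_nhds_hyperspace_iff.1 (le_refl (𝓝 K)) A _ (sub_pos.2 hc)] with L hL
  obtain ⟨τ, hτ, h⟩ := hL.2 σ hσ
  refine ⟨τ, hτ, ?_⟩
  have h1 := (RCLike.abs_re_le_norm (τ A - σ A)).trans_lt h
  rw [map_sub, abs_lt] at h1
  linarith [h1.1]

/-- By compactness the maximum on `K` is attained, leaving a positive gap below `c`. -/
theorem eventually_forall_re_lt {K : Hyperspace 𝕜 X} {A : X} {c : ℝ} (hK : IsCompact K.carrier)
    (hc : ∀ σ ∈ K.carrier, RCLike.re (σ A) < c) :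
    ∀ᶠ L in 𝓝 K, ∀ σ ∈ L.carrier, RCLike.re (σ A) < c := by
  obtain ⟨σ₀, hσ₀, hmax⟩ := hK.exists_isMaxOn K.2.1 (continuous_re_eval A).continuousOn
  filter_upwards [le_nhds_hyperspace_iff.1 (le_refl (𝓝 K)) A _ (sub_pos.2 (hc σ₀ hσ₀))] with L hL
  intro σ hσ
  obtain ⟨τ, hτ, h⟩ := hL.1 σ hσ
  have h1 := (RCLike.abs_re_le_norm (σ A - τ A)).trans_lt h
  rw [map_sub, abs_lt] at h1
  have h2 : RCLike.re (τ A) ≤ RCLike.re (σ₀ A) := hmax hτ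
  linarith [h1.2]

end HyperBasics

/-! ### Slices and extreme points of compact convex sets -/

section LocallyConvex

variable {E : Type*} [AddCommGroup E] [Module ℝ E] [TopologicalSpace E] [IsTopologicalAddGroup E]
  [ContinuousSMul ℝ E]

theorem isCompact_convexJoin {s t : Set E} (hs : IsCompact s) (ht : IsCompact t) :
    IsCompact (convexJoin ℝ s t) := by
  have h : convexJoin ℝ s t =
      (fun p : ℝ × E × E => (1 - p.1) • p.2.1 + p.1 • p.2.2) '' (Icc (0 : ℝ) 1 ×ˢ s ×ˢ t) := by
    ext x
    simp only [mem_convexJoin, segment_eq_image, mem_image, mem_prod, Prod.exists]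
    constructor
    · rintro ⟨a, ha, b, hb, θ, hθ, rfl⟩
      exact ⟨θ, a, b, ⟨hθ, ha, hb⟩, rfl⟩
    · rintro ⟨θ, a, b, ⟨hθ, ha, hb⟩, rfl⟩
      exact ⟨a, ha, b, hb, θ, hθ, rfl⟩
  rw [h]
  exact (isCompact_Icc.prod (hs.prod ht)).image (by fun_prop)

variable [T2Space E] [LocallyConvexSpace ℝ E]

/-- Every compact subset of a compact convex set that misses a given extreme point is contained in
a compact convex set missing that extreme point. -/
theorem exists_isCompact_convex_subset_sdiff {K Q : Set E} (hK : Convex ℝ K) (hKc : IsCompact K)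
    {ρ : E} (hρ : ρ ∈ K.extremePoints ℝ) (hQ : IsCompact Q) (hQK : Q ⊆ K \ {ρ}) :
    ∃ C, Q ⊆ C ∧ IsCompact C ∧ Convex ℝ C ∧ C ⊆ K \ {ρ} := by
  have hconv : Convex ℝ (K \ {ρ}) := (hK.mem_extremePoints_iff_convex_sdiff.1 hρ).2
  refine hQ.induction_on
    (p := fun S => ∃ C, S ⊆ C ∧ IsCompact C ∧ Convex ℝ C ∧ C ⊆ K \ {ρ}) ?_ ?_ ?_ ?_
  · exact ⟨∅, Subset.rfl, isCompact_empty, convex_empty, empty_subset _⟩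
  · rintro S T hST ⟨C, hC, h⟩
    exact ⟨C, hST.trans hC, h⟩
  · rintro S T ⟨C, hSC, hC, hC', hCK⟩ ⟨D, hTD, hD, hD', hDK⟩
    rcases C.eq_empty_or_nonempty with rfl | hCn
    · exact ⟨D, union_subset (hSC.trans (empty_subset _)) hTD, hD, hD', hDK⟩
    rcases D.eq_empty_or_nonempty with rfl | hDn
    · exact ⟨C, union_subset hSC (hTD.trans (empty_subset _)), hC, hC', hCK⟩
    have h := hC'.convexHull_union hD' hCn hDn
    refine ⟨convexHull ℝ (C ∪ D), (union_subset_union hSC hTD).trans (subset_convexHull ℝ _),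
      h ▸ isCompact_convexJoin hC hD, convex_convexHull ℝ _,
      convexHull_min (union_subset hCK hDK) hconv⟩
  · intro q hq
    -- Locally at `q`, the convex set is the part of `K` in a closed half-space containing a
    -- neighbourhood of `q` but not `ρ`.
    obtain ⟨f, hf⟩ := geometric_hahn_banach_point_point (E := E) (hQK hq).2
    obtain ⟨c, h1, h2⟩ := exists_between hf
    refine ⟨{x ∈ Q | f x ≤ c}, ?_, K ∩ {x | f x ≤ c}, fun x hx => ⟨(hQK hx.1).1, hx.2⟩,
      hKc.inter_right (isClosed_le f.continuous continuous_const),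
      hK.inter (convex_halfSpace_le f.isLinear c), ?_⟩
    · filter_upwards [self_mem_nhdsWithin, mem_nhdsWithin_of_mem_nhds
        ((f.continuous.tendsto q).eventually_lt_const h1)] with x hx hx'
      exact ⟨hx, le_of_lt hx'⟩
    · rintro x ⟨hx, hx'⟩
      refine ⟨hx, ?_⟩
      rintro rfl
      exact absurd h2 (not_lt.2 hx')

/-- Slices form a neighbourhood basis of each extreme point of a compact convex set. -/
theorem exists_slice_subset {K V : Set E} (hK : Convex ℝ K) (hKc : IsCompact K)
    {ρ : E} (hρ : ρ ∈ K.extremePoints ℝ) (hV : IsOpen V) (hρV : ρ ∈ V) :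
    ∃ (f : StrongDual ℝ E) (c : ℝ), c < f ρ ∧ ∀ σ ∈ K, c ≤ f σ → σ ∈ V := by
  obtain ⟨C, hQC, hC, hC', hCK⟩ := exists_isCompact_convex_subset_sdiff hK hKc hρ
    (hKc.diff hV) (sdiff_subset_sdiff_right (singleton_subset_iff.2 hρV))
  obtain ⟨f, c, h1, h2⟩ := geometric_hahn_banach_closed_point hC' hC.isClosed
    (fun h => (hCK h).2 rfl)
  refine ⟨f, c, h2, fun σ hσ hc => ?_⟩
  by_contra hσV
  exact absurd (h1 σ (hQC ⟨hσ, hσV⟩)) (not_lt.2 hc)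

/-- Every open half-space that meets a compact set contains an extreme point of that set. -/
theorem exists_mem_extremePoints_lt {K : Set E} (hKc : IsCompact K) (f : StrongDual ℝ E) {c : ℝ}
    {σ : E} (hσ : σ ∈ K) (hc : c < f σ) : ∃ ρ ∈ K.extremePoints ℝ, c < f ρ := by
  obtain ⟨τ, hτ, hmax⟩ := hKc.exists_isMaxOn ⟨σ, hσ⟩ f.continuous.continuousOn
  -- The face where `f` is maximal is compact and nonempty, so it has an extreme point, which is
  -- extreme in `K` too.
  have hexp : IsExposed ℝ K (f.toExposed K) := ContinuousLinearMap.toExposed.isExposed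
  obtain ⟨ρ, hρ⟩ := (hexp.isCompact hKc).extremePoints_nonempty ⟨τ, hτ, hmax⟩
  exact ⟨ρ, hexp.isExtreme.extremePoints_subset_extremePoints hρ, hc.trans_le (hρ.1.2 σ hσ)⟩

end LocallyConvex

/-! ### Stability of disjointness and of extreme points -/

section Vietoris

variable {𝕜 : Type*} [RCLike 𝕜] {X : Type*} [AddCommGroup X] [Module 𝕜 X] [TopologicalSpace X]

theorem exists_continuousLinearMap_eq_re_eval (A : X) :
    ∃ f : WeakDual 𝕜 X →L[ℝ] ℝ, ∀ σ, f σ = RCLike.re (σ A) :=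
  ⟨⟨RCLike.reLm ∘ₗ evalReal A, continuous_re_eval A⟩, fun _ => rfl⟩

theorem exists_slice_subset_weakDual {K V : Set (WeakDual 𝕜 X)} (hK : Convex ℝ K)
    (hKc : IsCompact K) {ρ : WeakDual 𝕜 X} (hρ : ρ ∈ K.extremePoints ℝ) (hV : IsOpen V)
    (hρV : ρ ∈ V) :
    ∃ (A : X) (c : ℝ), c < RCLike.re (ρ A) ∧ ∀ σ ∈ K, c ≤ RCLike.re (σ A) → σ ∈ V := by
  rw [extremePoints_eq_extremePoints_module] at hρ
  obtain ⟨f, c, h1, h2⟩ := exists_slice_subset (convex_iff_convex_module.1 hK) hKc hρ hV hρV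
  obtain ⟨A, hA⟩ := exists_forall_eq_re_eval f
  exact ⟨A, c, hA ρ ▸ h1, fun σ hσ hc => h2 σ hσ ((hA σ).symm ▸ hc)⟩

theorem exists_mem_extremePoints_lt_re {K : Set (WeakDual 𝕜 X)} (hKc : IsCompact K) {A : X}
    {c : ℝ} {σ : WeakDual 𝕜 X} (hσ : σ ∈ K) (hc : c < RCLike.re (σ A)) :
    ∃ ρ ∈ K.extremePoints ℝ, c < RCLike.re (ρ A) := by
  obtain ⟨f, hf⟩ := exists_continuousLinearMap_eq_re_eval (𝕜 := 𝕜) A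
  rw [extremePoints_eq_extremePoints_module]
  obtain ⟨ρ, h1, h2⟩ := exists_mem_extremePoints_lt hKc f hσ (hf σ ▸ hc)
  exact ⟨ρ, h1, hf ρ ▸ h2⟩

/-- The pseudometrics control only one direction at a time; convexity of `K` makes this enough,
since finitely many separating half-spaces cover `Q`. -/
theorem eventually_disjoint {K : Hyperspace 𝕜 X} (hK : Convex ℝ K.carrier)
    (hKc : IsCompact K.carrier) {Q : Set (WeakDual 𝕜 X)} (hQ : IsCompact Q)
    (hKQ : Disjoint K.carrier Q) : ∀ᶠ L in 𝓝 K, Disjoint L.carrier Q := by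
  refine hQ.induction_on (p := fun S => ∀ᶠ L in 𝓝 K, Disjoint L.carrier S) ?_ ?_ ?_ ?_
  · simp
  · exact fun S T hST h => h.mono fun L hL => hL.mono_right hST
  · exact fun S T hS hT => (hS.and hT).mono fun L hL => disjoint_union_right.2 hL
  · intro q hq
    obtain ⟨A, c, h1, h2⟩ := exists_separating_vector hK K.2.2 (disjoint_right.1 hKQ hq)
    refine ⟨{σ | c < RCLike.re (σ A)}, mem_nhdsWithin_of_mem_nhds
      ((isOpen_lt continuous_const (continuous_re_eval A)).mem_nhds h2), ?_⟩
    filter_upwards [eventually_forall_re_lt hKc h1] with L hL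
    exact disjoint_left.2 fun σ hσ hσ' => lt_asymm (hL σ hσ) hσ'

theorem Hyperspace.ext {K L : Hyperspace 𝕜 X} (h : K.carrier = L.carrier) : K = L :=
  Subtype.ext h

theorem exists_disjoint_nhds_of_not_subset {K L : Hyperspace 𝕜 X} (hK : Convex ℝ K.carrier)
    (hKc : IsCompact K.carrier) (h : ¬ L.carrier ⊆ K.carrier) : Disjoint (𝓝 K) (𝓝 L) := by
  obtain ⟨σ, hσ, hσ'⟩ := not_subset.1 h
  obtain ⟨A, c, h1, h2⟩ := exists_separating_vector hK K.2.2 hσ'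
  rw [Filter.disjoint_iff]
  refine ⟨_, eventually_forall_re_lt hKc h1, _, eventually_exists_lt_re hσ h2, ?_⟩
  rw [Set.disjoint_left]
  rintro M hM ⟨τ, hτ, hτ'⟩
  exact lt_asymm (hM τ hτ) hτ'

variable [IsTopologicalAddGroup X] [ContinuousSMul 𝕜 X]

theorem isCompact_carrier {U : Set X} (hU : U ∈ 𝓝 (0 : X)) {K : Hyperspace 𝕜 X}
    (hK : K ∈ CUsub 𝕜 U) : IsCompact K.carrier :=
  (isCompact_polar hU).of_isClosed_subset K.2.2 hK.2

theorem disjoint_nhds_of_ne {U V : Set X} (hU : U ∈ 𝓝 (0 : X)) (hV : V ∈ 𝓝 (0 : X))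
    {K L : Hyperspace 𝕜 X} (hK : K ∈ CUsub 𝕜 U) (hL : L ∈ CUsub 𝕜 V) (hne : K ≠ L) :
    Disjoint (𝓝 K) (𝓝 L) := by
  by_cases h : L.carrier ⊆ K.carrier
  · refine (exists_disjoint_nhds_of_not_subset hL.1 (isCompact_carrier hV hL) fun h' => hne ?_).symm
    exact Hyperspace.ext (h'.antisymm h)
  · exact exists_disjoint_nhds_of_not_subset hK.1 (isCompact_carrier hU hK) h

/-- Having an extreme point in a given open set is an open condition. -/
theorem eventually_extremePoints_inter_nonempty {U : Set X} (hU : U ∈ 𝓝 (0 : X))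
    {K : Hyperspace 𝕜 X} (hK : K ∈ CUsub 𝕜 U) {V : Set (WeakDual 𝕜 X)} (hV : IsOpen V)
    (hKV : (K.carrier.extremePoints ℝ ∩ V).Nonempty) :
    ∀ᶠ L in 𝓝 K, L ∈ CUsub 𝕜 U → (L.carrier.extremePoints ℝ ∩ V).Nonempty := by
  obtain ⟨ρ, hρ, hρV⟩ := hKV
  have hKc := isCompact_carrier hU hK
  obtain ⟨A, c, h1, h2⟩ := exists_slice_subset_weakDual hK.1 hKc hρ hV hρV
  -- A nearby `L` misses this compact set yet enters the slice; an extreme point of `L` in the slice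
  -- must then lie in `V`.
  have hQ : IsCompact ((WeakDual.polar 𝕜 U ∩ {σ | c ≤ RCLike.re (σ A)}) \ V) :=
    ((isCompact_polar hU).inter_right
      (isClosed_le continuous_const (continuous_re_eval A))).diff hV
  have hKQ : Disjoint K.carrier ((WeakDual.polar 𝕜 U ∩ {σ | c ≤ RCLike.re (σ A)}) \ V) :=
    disjoint_left.2 fun σ hσ hσ' => hσ'.2 (h2 σ hσ hσ'.1.2)
  filter_upwards [eventually_disjoint hK.1 hKc hQ hKQ, eventually_exists_lt_re hρ.1 h1]
    with L hLQ ⟨τ, hτ, hc⟩ hL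
  obtain ⟨ξ, hξ, hξc⟩ := exists_mem_extremePoints_lt_re (isCompact_carrier hU hL) hτ hc
  refine ⟨ξ, hξ, ?_⟩
  by_contra hξV
  exact disjoint_left.1 hLQ hξ.1 ⟨⟨hL.2 hξ.1, hξc.le⟩, hξV⟩

end Vietoris

/-! ### Compactness of the hyperspace over one polar -/

section Compactness

variable {𝕜 : Type*} [RCLike 𝕜] {X : Type*} [AddCommGroup X] [Module 𝕜 X] [TopologicalSpace X]

/-- The set of all points each of whose neighbourhoods meets almost all members of a filter of
closed sets. -/
def kuratowskiLimit (l : Filter (Hyperspace 𝕜 X)) : Set (WeakDual 𝕜 X) :=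
  {σ | ∀ V : Set (WeakDual 𝕜 X), IsOpen V → σ ∈ V → ∀ᶠ L in l, (L.carrier ∩ V).Nonempty}

theorem isClosed_kuratowskiLimit (l : Filter (Hyperspace 𝕜 X)) :
    IsClosed (kuratowskiLimit l) := by
  refine isClosed_of_closure_subset fun σ hσ V hV hσV => ?_
  obtain ⟨τ, hτV, hτ⟩ := mem_closure_iff.1 hσ V hV hσV
  exact hτ V hV hτV

theorem convex_kuratowskiLimit {l : Filter (Hyperspace 𝕜 X)}
    (hl : ∀ᶠ L in l, Convex ℝ L.carrier) : Convex ℝ (kuratowskiLimit l) := by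
  intro σ hσ τ hτ a b ha hb hab V hV hmem
  have hcont : Continuous fun p : WeakDual 𝕜 X × WeakDual 𝕜 X => a • p.1 + b • p.2 := by fun_prop
  obtain ⟨V₁, V₂, h1, h2, hσ1, hτ2, hsub⟩ :=
    isOpen_prod_iff.1 (hV.preimage hcont) σ τ hmem
  filter_upwards [hl, hσ V₁ h1 hσ1, hτ V₂ h2 hτ2] with L hL ⟨σ', hσ', hσV⟩ ⟨τ', hτ', hτV⟩
  exact ⟨_, hL hσ' hτ' ha hb hab, hsub (mk_mem_prod hσV hτV)⟩

theorem mem_kuratowskiLimit_of_tendsto {l : Filter (Hyperspace 𝕜 X)}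
    {s : Hyperspace 𝕜 X → WeakDual 𝕜 X} (hs : ∀ᶠ L in l, s L ∈ L.carrier) {σ : WeakDual 𝕜 X}
    (h : Tendsto s l (𝓝 σ)) : σ ∈ kuratowskiLimit l := fun V hV hσV => by
  filter_upwards [hs, h (hV.mem_nhds hσV)] with L h1 h2 using ⟨s L, h1, h2⟩

theorem exists_tendsto_of_eventually_mem {Q : Set (WeakDual 𝕜 X)} (hQ : IsCompact Q)
    {l : Ultrafilter (Hyperspace 𝕜 X)} {s : Hyperspace 𝕜 X → WeakDual 𝕜 X}
    (hs : ∀ᶠ L in (l : Filter (Hyperspace 𝕜 X)), s L ∈ Q) : ∃ σ ∈ Q, Tendsto s l (𝓝 σ) :=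
  hQ.ultrafilter_le_nhds (l.map s) (le_principal_iff.2 hs)

variable [IsTopologicalAddGroup X] [ContinuousSMul 𝕜 X]

/-- An ultrafilter converges to its Kuratowski limit, because any selection of points from its
members converges in the compact polar. -/
theorem isCompact_CUsub {U : Set X} (hU : U ∈ 𝓝 (0 : X)) : IsCompact (CUsub 𝕜 U) := by
  rw [isCompact_iff_ultrafilter_le_nhds]
  intro l hl
  have hl' : ∀ᶠ L in (l : Filter (Hyperspace 𝕜 X)), L ∈ CUsub 𝕜 U := le_principal_iff.1 hl
  have hP := isCompact_polar (𝕜 := 𝕜) hU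
  have hlim : ∀ s : Hyperspace 𝕜 X → WeakDual 𝕜 X,
      (∀ᶠ L in (l : Filter (Hyperspace 𝕜 X)), s L ∈ L.carrier) →
      ∃ σ ∈ kuratowskiLimit (l : Filter (Hyperspace 𝕜 X)), Tendsto s l (𝓝 σ) := by
    intro s hs
    obtain ⟨σ, -, hσ⟩ := exists_tendsto_of_eventually_mem hP
      (hs.and hl' |>.mono fun L hL => hL.2.2 hL.1)
    exact ⟨σ, mem_kuratowskiLimit_of_tendsto hs hσ, hσ⟩
  have hsub : kuratowskiLimit (l : Filter (Hyperspace 𝕜 X)) ⊆ WeakDual.polar 𝕜 U := by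
    intro σ hσ
    by_contra h
    obtain ⟨L, hL, τ, hτ, hτ'⟩ :=
      (hl'.and (hσ _ (WeakDual.isClosed_polar 𝕜 U).isOpen_compl h)).exists
    exact hτ' (hL.2 hτ)
  have hne : (kuratowskiLimit (l : Filter (Hyperspace 𝕜 X))).Nonempty := by
    obtain ⟨σ, hσ, -⟩ := hlim (fun L => L.2.1.some) (Eventually.of_forall fun L => L.2.1.some_mem)
    exact ⟨σ, hσ⟩
  let K : Hyperspace 𝕜 X := ⟨kuratowskiLimit l, hne, isClosed_kuratowskiLimit _⟩
  have hK : K ∈ CUsub 𝕜 U := ⟨convex_kuratowskiLimit (hl'.mono fun L hL => hL.1), hsub⟩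
  refine ⟨K, hK, le_nhds_hyperspace_iff.2 fun A ε hε => Eventually.and ?_ ?_⟩
  · by_contra h
    -- For an ultrafilter, failure happens eventually; selected points that stay `ε`-far from `K`
    -- would then converge to a point of `K`.
    rw [← Ultrafilter.eventually_not] at h
    have h' : ∀ L : Hyperspace 𝕜 X, ∃ σ ∈ L.carrier,
        (¬ ∀ σ ∈ L.carrier, ∃ τ ∈ K.carrier, ‖σ A - τ A‖ < ε) →
          ∀ τ ∈ K.carrier, ε ≤ ‖σ A - τ A‖ := by
      intro L
      by_cases hL : ∀ σ ∈ L.carrier, ∃ τ ∈ K.carrier, ‖σ A - τ A‖ < ε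
      · exact ⟨_, L.2.1.some_mem, fun h => absurd hL h⟩
      · push Not at hL
        obtain ⟨σ, hσ, h⟩ := hL
        exact ⟨σ, hσ, fun _ => h⟩
    choose s hs hs' using h'
    obtain ⟨σ, hσ, hlimσ⟩ := hlim s (Eventually.of_forall hs)
    have h2 := tendsto_weakDual_iff.1 hlimσ A
    have h3 : ∀ᶠ L in (l : Filter (Hyperspace 𝕜 X)), ‖s L A - σ A‖ < ε := by
      simpa [dist_eq_norm] using Metric.tendsto_nhds.1 h2 ε hε
    obtain ⟨L, hL, hL'⟩ := (h.and h3).exists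
    exact absurd hL' (not_lt.2 (hs' L hL σ hσ))
  · by_contra h
    rw [← Ultrafilter.eventually_not] at h
    have h' : ∀ L : Hyperspace 𝕜 X, ∃ τ ∈ K.carrier,
        (¬ ∀ τ ∈ K.carrier, ∃ σ ∈ L.carrier, ‖σ A - τ A‖ < ε) →
          ∀ σ ∈ L.carrier, ε ≤ ‖σ A - τ A‖ := by
      intro L
      by_cases hL : ∀ τ ∈ K.carrier, ∃ σ ∈ L.carrier, ‖σ A - τ A‖ < ε
      · exact ⟨_, K.2.1.some_mem, fun h => absurd hL h⟩
      · push Not at hL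
        obtain ⟨τ, hτ, h⟩ := hL
        exact ⟨τ, hτ, fun _ => h⟩
    choose t ht ht' using h'
    -- The far points `t L` lie in `K` and cluster at `τ`, while members of `L` also approach `τ`:
    -- half of `ε` for each.
    obtain ⟨τ, hτ, hlimτ⟩ := exists_tendsto_of_eventually_mem (isCompact_carrier hU hK)
      (l := l) (Eventually.of_forall ht)
    have h2 : ∀ᶠ L in (l : Filter (Hyperspace 𝕜 X)), ‖t L A - τ A‖ < ε / 2 := by
      simpa [dist_eq_norm] using
        Metric.tendsto_nhds.1 (tendsto_weakDual_iff.1 hlimτ A) (ε / 2) (half_pos hε)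
    have h3 := hτ {σ | ‖σ A - τ A‖ < ε / 2}
      (isOpen_lt ((WeakDual.eval_continuous A).sub continuous_const).norm continuous_const)
      (by simpa using half_pos hε)
    obtain ⟨L, hL, hL2, σ, hσL, hσ⟩ := (h.and (h2.and h3)).exists
    refine absurd (ht' L hL σ hσL) (not_le.2 ?_)
    have hσ : ‖σ A - τ A‖ < ε / 2 := hσ
    calc ‖σ A - t L A‖ ≤ ‖σ A - τ A‖ + ‖t L A - τ A‖ := by
          rw [norm_sub_rev (t L A)]; exact norm_sub_le_norm_sub_add_norm_sub _ _ _
      _ < ε := by linarith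

end Compactness

/-! ### Extreme points of a hull with one added point -/

section ConvexHull

variable {E : Type*} [AddCommGroup E] [Module ℝ E]

/-- Adding a point outside a convex hull makes it an extreme point of the new convex hull. -/
theorem mem_extremePoints_convexHull_insert {T : Set E} (hT : T.Nonempty) {x : E}
    (hx : x ∉ convexHull ℝ T) : x ∈ (convexHull ℝ (insert x T)).extremePoints ℝ := by
  rw [(convex_convexHull ℝ _).mem_extremePoints_iff_convex_sdiff]
  refine ⟨subset_convexHull ℝ _ (mem_insert _ _), ?_⟩
  have hmem : ∀ y ∈ convexHull ℝ (insert x T) \ {x},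
      ∃ c ∈ convexHull ℝ T, ∃ θ : ℝ, 0 < θ ∧ y - x = θ • (c - x) := by
    rintro y ⟨hy, hyx⟩
    rw [convexHull_insert hT, convexJoin_singleton_left] at hy
    simp only [mem_iUnion, exists_prop, segment_eq_image'] at hy
    obtain ⟨c, hc, θ, hθ, rfl⟩ := hy
    refine ⟨c, hc, θ, lt_of_le_of_ne hθ.1 ?_, by simp⟩
    rintro rfl
    exact hyx (by simp)
  intro y hy z hz a b ha hb hab
  refine ⟨convex_convexHull ℝ _ hy.1 hz.1 ha hb hab, fun h => hx ?_⟩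
  obtain ⟨c, hc, θ, hθ, hyc⟩ := hmem y hy
  obtain ⟨d, hd, η, hη, hzd⟩ := hmem z hz
  have hpos : 0 < a * θ + b * η := by
    rcases ha.eq_or_lt with rfl | ha'
    · have : b = 1 := by linarith
      subst this; linarith
    · have := mul_pos ha' hθ
      have := mul_nonneg hb hη.le
      linarith
  -- If `x` lay between `y` and `z`, rescaling along the rays from `x` would put it between `c` and
  -- `d`, inside the hull of `T`.
  have h0 : (a * θ) • (c - x) + (b * η) • (d - x) = 0 := by
    rw [mul_smul, mul_smul, ← hyc, ← hzd]
    have h : a • y + b • z = x := h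
    have h1 : a • (y - x) + b • (z - x) = (a • y + b • z) - (a + b) • x := by module
    rw [h1, h, hab, one_smul, sub_self]
  have h1 : x = (a * θ / (a * θ + b * η)) • c + (b * η / (a * θ + b * η)) • d := by
    have h2 : (a * θ + b * η) • x = (a * θ) • c + (b * η) • d := by
      have h3 : (a * θ) • c + (b * η) • d =
        ((a * θ) • (c - x) + (b * η) • (d - x)) + (a * θ + b * η) • x := by module
      rw [h3, h0, zero_add]
    rw [div_eq_inv_mul, div_eq_inv_mul, mul_smul _ (a * θ), mul_smul _ (b * η), ← smul_add, ← h2,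
      inv_smul_smul₀ hpos.ne']
  rw [h1]
  exact convex_convexHull ℝ _ hc hd (by positivity) (by positivity)
    (by rw [← add_div, div_self hpos.ne'])

end ConvexHull

/-! ### Approximation by polytopes -/

section Approximation

variable {𝕜 : Type*} [RCLike 𝕜] {X : Type*} [AddCommGroup X] [Module 𝕜 X] [TopologicalSpace X]

theorem convex_polar (U : Set X) : Convex ℝ (WeakDual.polar 𝕜 U) := by
  intro σ hσ τ hτ a b ha hb hab A hA
  have h1 : ‖σ A‖ ≤ 1 := hσ A hA
  have h2 : ‖τ A‖ ≤ 1 := hτ A hA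
  calc ‖a • σ A + b • τ A‖ ≤ a * ‖σ A‖ + b * ‖τ A‖ := by
        refine (norm_add_le _ _).trans_eq ?_
        rw [norm_smul, norm_smul, Real.norm_of_nonneg ha, Real.norm_of_nonneg hb]
    _ ≤ a * 1 + b * 1 := by gcongr
    _ = 1 := by linarith

theorem convex_submodule (W : Submodule 𝕜 (WeakDual 𝕜 X)) :
    Convex ℝ (W : Set (WeakDual 𝕜 X)) := by
  intro σ hσ τ hτ a b _ _ _
  exact W.add_mem (W.smul_of_tower_mem a hσ) (W.smul_of_tower_mem b hτ)

theorem InfiniteDimensionalPolar.exists_notMem {U : Set X} (h : InfiniteDimensionalPolar 𝕜 U)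
    (W : Submodule 𝕜 (WeakDual 𝕜 X)) [FiniteDimensional 𝕜 W] :
    ∃ τ ∉ W, ∃ C : ℝ, 0 ≤ C ∧ ∀ A ∈ U, ‖τ A‖ ≤ C := by
  obtain ⟨σ, hσ, hb⟩ := h
  have hn : ∃ n, σ n ∉ W := by
    by_contra! hW
    have hli : LinearIndependent 𝕜 (fun n => (⟨σ n, hW n⟩ : W)) :=
      LinearIndependent.of_comp W.subtype hσ
    exact not_finite_iff_infinite.2 (inferInstanceAs (Infinite ℕ)) hli.finite
  obtain ⟨n, hn⟩ := hn
  obtain ⟨C, hC⟩ := hb n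
  -- The maximum with `0` matters when `U` is empty, as `C` may then be negative.
  exact ⟨σ n, hn, max C 0, le_max_right _ _,
    fun A hA => (hC (mem_image_of_mem _ hA)).trans (le_max_left _ _)⟩

theorem convex_setOf_exists_norm_sub_lt {K : Set (WeakDual 𝕜 X)} (hK : Convex ℝ K) (A : X)
    (ε : ℝ) : Convex ℝ {σ : WeakDual 𝕜 X | ∃ κ ∈ K, ‖σ A - κ A‖ < ε} := by
  rintro σ ⟨κ, hκ, h1⟩ τ ⟨ξ, hξ, h2⟩ a b ha hb hab
  refine ⟨_, hK hκ hξ ha hb hab, ?_⟩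
  have h3 : (a • σ + b • τ) A - (a • κ + b • ξ) A = a • (σ A - κ A) + b • (τ A - ξ A) := by
    change (a • σ A + b • τ A) - (a • κ A + b • ξ A) = _
    module
  have hball := convex_ball (0 : 𝕜) ε (mem_ball_zero_iff.2 h1) (mem_ball_zero_iff.2 h2) ha hb hab
  rw [h3]
  exact mem_ball_zero_iff.1 hball

theorem mem_extremePoints_convexHull_insert_of_notMem {T : Set (WeakDual 𝕜 X)}
    {W : Submodule 𝕜 (WeakDual 𝕜 X)} (hT : T.Nonempty) (hTW : T ⊆ W) {p : WeakDual 𝕜 X}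
    (hp : p ∉ W) : p ∈ (convexHull ℝ (insert p T)).extremePoints ℝ :=
  mem_extremePoints_convexHull_insert (E := WeakDual 𝕜 X) hT fun h =>
    hp (convexHull_min hTW (convex_iff_convex_module.1 (convex_submodule W)) h)

/-- Near every member of `CUsub 𝕜 U` that meets an open set `V` there is a polytope in
`CUsub 𝕜 U` having an extreme point in `V`. -/
theorem exists_polytope_nearby {U : Set X} (hU : InfiniteDimensionalPolar 𝕜 U)
    {K : Hyperspace 𝕜 X} (hK : K ∈ CUsub 𝕜 U) (hKc : IsCompact K.carrier)
    {V : Set (WeakDual 𝕜 X)} (hV : IsOpen V) (hKV : (K.carrier ∩ V).Nonempty)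
    (S : Finset X) {ε : ℝ} (hε : 0 < ε) :
    ∃ L ∈ CUsub 𝕜 U, (L.carrier.extremePoints ℝ ∩ V).Nonempty ∧ ∀ A ∈ S,
      (∀ σ ∈ L.carrier, ∃ τ ∈ K.carrier, ‖σ A - τ A‖ < ε) ∧
      ∀ τ ∈ K.carrier, ∃ σ ∈ L.carrier, ‖σ A - τ A‖ < ε := by
  obtain ⟨σ₀, hσ₀, hσ₀V⟩ := hKV
  have hcov : ∀ t ∈ K.carrier, {σ : WeakDual 𝕜 X | ∀ A ∈ S, ‖t A - σ A‖ < ε / 2} ∈ 𝓝 t := by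
    intro t _
    refine (Filter.eventually_all_finset S).2 fun A _ => ?_
    have hc : Continuous fun σ : WeakDual 𝕜 X => ‖t A - σ A‖ :=
      (continuous_const.sub (WeakDual.eval_continuous A)).norm
    exact (isOpen_lt hc continuous_const).mem_nhds (by simpa using half_pos hε)
  -- `T` is a finite `ε / 2`-net of `K` for all seminorms from `S` at once.
  obtain ⟨T, hTK, hT⟩ := hKc.elim_nhds_subcover _ hcov
  have hTne : (T : Set (WeakDual 𝕜 X)).Nonempty := by
    obtain ⟨t, ht, -⟩ := mem_iUnion₂.1 (hT hσ₀)
    exact ⟨t, ht⟩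
  let W : Submodule 𝕜 (WeakDual 𝕜 X) := Submodule.span 𝕜 (insert σ₀ (T : Set (WeakDual 𝕜 X)))
  have : FiniteDimensional 𝕜 W := FiniteDimensional.span_of_finite 𝕜 (T.finite_toSet.insert σ₀)
  obtain ⟨τ, hτW, C, hC, hCU⟩ := hU.exists_notMem W
  -- Shrinking by `1 - C * s` leaves exactly the room needed to add `s • τ` without leaving the
  -- polar.
  let g : ℝ → WeakDual 𝕜 X → WeakDual 𝕜 X := fun s t => (1 - C * s) • t
  let p : ℝ → WeakDual 𝕜 X := fun s => g s σ₀ + s • τ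
  have hsmul : ∀ (f : ℝ → ℝ) (t : WeakDual 𝕜 X), Continuous f → Continuous fun s => f s • t :=
    fun f t hf => (continuous_smul (M := ℝ) (X := WeakDual 𝕜 X)).comp (hf.prodMk continuous_const)
  have hgc : ∀ t, Continuous fun s => g s t := fun t =>
    hsmul (fun s => 1 - C * s) t (by fun_prop)
  have hpc : Continuous p := (hgc σ₀).add (hsmul (fun s => s) τ continuous_id')
  have hg0 : ∀ t, g 0 t = t := fun t => by simp [g]
  have hp0 : p 0 = σ₀ :=
    (congrArg₂ (· + ·) (hg0 σ₀) (zero_smul ℝ τ)).trans (add_zero _)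
  have hnear : ∀ (q : ℝ → WeakDual 𝕜 X) (t : WeakDual 𝕜 X), Continuous q → q 0 = t → ∀ A : X,
      ∀ᶠ s in 𝓝[>] (0 : ℝ), ‖q s A - t A‖ < ε / 2 := by
    intro q t hq hq0 A
    have hc : Continuous fun s => ‖q s A - t A‖ :=
      (((WeakDual.eval_continuous A).comp hq).sub continuous_const).norm
    exact mem_nhdsWithin_of_mem_nhds
      ((isOpen_lt hc continuous_const).mem_nhds (by simpa [hq0] using half_pos hε))
  have h1 : ∀ᶠ s in 𝓝[>] (0 : ℝ), ∀ t ∈ T, ∀ A ∈ S, ‖g s t A - t A‖ < ε / 2 :=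
    (Filter.eventually_all_finset T).2 fun t _ => (Filter.eventually_all_finset S).2 fun A _ =>
      hnear _ t (hgc t) (hg0 t) A
  have h2 : ∀ᶠ s in 𝓝[>] (0 : ℝ), ∀ A ∈ S, ‖p s A - σ₀ A‖ < ε / 2 :=
    (Filter.eventually_all_finset S).2 fun A _ => hnear p σ₀ hpc hp0 A
  have h3 : ∀ᶠ s in 𝓝[>] (0 : ℝ), p s ∈ V :=
    mem_nhdsWithin_of_mem_nhds ((hV.preimage hpc).mem_nhds (by simpa [hp0] using hσ₀V))
  have h4 : ∀ᶠ s in 𝓝[>] (0 : ℝ), C * s < 1 := by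
    have hc : Continuous fun s : ℝ => C * s := by fun_prop
    exact mem_nhdsWithin_of_mem_nhds ((isOpen_lt hc continuous_const).mem_nhds (by simp))
  obtain ⟨s, h1, h2, h3, h4, hs⟩ :=
    (h1.and (h2.and (h3.and (h4.and self_mem_nhdsWithin)))).exists
  have hs : 0 < s := hs
  have hCs : 0 ≤ 1 - C * s := by linarith
  let Q : Set (WeakDual 𝕜 X) := insert (p s) (g s '' T)
  have hQ : Q.Finite := (T.finite_toSet.image _).insert _
  have hgW : ∀ t ∈ W, g s t ∈ W := fun t ht => W.smul_of_tower_mem _ ht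
  have hpW : p s ∉ W := by
    intro h
    have h5 : s • τ ∈ W := by
      have := W.sub_mem h (hgW σ₀ (Submodule.subset_span (mem_insert _ _)))
      simpa [p] using this
    have h6 := W.smul_of_tower_mem s⁻¹ h5
    rw [inv_smul_smul₀ hs.ne'] at h6
    exact hτW h6
  have hext : p s ∈ (convexHull ℝ Q).extremePoints ℝ := by
    refine mem_extremePoints_convexHull_insert_of_notMem (hTne.image _) ?_ hpW
    rintro _ ⟨t, ht, rfl⟩
    exact hgW t (Submodule.subset_span (mem_insert_of_mem _ ht))
  have hcomp : IsCompact (convexHull ℝ Q) := hQ.isCompact_convexHull ℝ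
  let L : Hyperspace 𝕜 X := ⟨convexHull ℝ Q, ⟨p s, hext.1⟩, hcomp.isClosed⟩
  have hgU : ∀ t ∈ K.carrier, ∀ A ∈ U, ‖g s t A‖ ≤ 1 - C * s := by
    intro t ht A hA
    have h5 : ‖t A‖ ≤ 1 := hK.2 ht A hA
    calc ‖(1 - C * s) • t A‖ = (1 - C * s) * ‖t A‖ := by
          rw [norm_smul, Real.norm_of_nonneg hCs]
      _ ≤ 1 - C * s := mul_le_of_le_one_right hCs h5
  have hLU : convexHull ℝ Q ⊆ WeakDual.polar 𝕜 U := by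
    refine convexHull_min ?_ (convex_iff_convex_module.1 (convex_polar U))
    rintro q (rfl | ⟨t, ht, rfl⟩)
    · intro A hA
      calc ‖g s σ₀ A + s • τ A‖ ≤ ‖g s σ₀ A‖ + s * ‖τ A‖ := by
            refine (norm_add_le _ _).trans_eq ?_
            rw [norm_smul, Real.norm_of_nonneg hs.le]
        _ ≤ (1 - C * s) + s * C := add_le_add (hgU σ₀ hσ₀ A hA)
            (mul_le_mul_of_nonneg_left (hCU A hA) hs.le)
        _ = 1 := by ring
    · intro A hA
      have h5 := hgU t (hTK t ht) A hA
      have h6 : 0 ≤ C * s := mul_nonneg hC hs.le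
      exact h5.trans (by linarith)
  refine ⟨L, ⟨convex_iff_convex_module.2 (convex_convexHull ℝ Q), hLU⟩, ⟨p s, hext, h3⟩,
    fun A hA => ⟨?_, ?_⟩⟩
  · refine convexHull_min (t := {σ : WeakDual 𝕜 X | ∃ κ ∈ K.carrier, ‖σ A - κ A‖ < ε}) ?_
      (convex_iff_convex_module.1 (convex_setOf_exists_norm_sub_lt hK.1 A ε))
    rintro q (rfl | ⟨t, ht, rfl⟩)
    · exact ⟨σ₀, hσ₀, (h2 A hA).trans (half_lt_self hε)⟩
    · exact ⟨t, hTK t ht, (h1 t ht A hA).trans (half_lt_self hε)⟩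
  · intro κ hκ
    obtain ⟨t, ht, htκ⟩ := mem_iUnion₂.1 (hT hκ)
    refine ⟨g s t, subset_convexHull ℝ Q (mem_insert_of_mem _ (mem_image_of_mem _ ht)), ?_⟩
    calc ‖g s t A - κ A‖ ≤ ‖g s t A - t A‖ + ‖t A - κ A‖ :=
          norm_sub_le_norm_sub_add_norm_sub _ _ _
      _ < ε := by linarith [h1 t ht A hA, htκ A hA]

theorem frequently_extremePoints_inter_nonempty {U : Set X} (hU : InfiniteDimensionalPolar 𝕜 U)
    {K : Hyperspace 𝕜 X} (hK : K ∈ CUsub 𝕜 U) (hKc : IsCompact K.carrier)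
    {V : Set (WeakDual 𝕜 X)} (hV : IsOpen V) (hKV : (K.carrier ∩ V).Nonempty) :
    ∃ᶠ L in 𝓝 K, L ∈ CUsub 𝕜 U ∧ (L.carrier.extremePoints ℝ ∩ V).Nonempty := by
  classical
  choose L hLU hLV hL using fun i : Finset X × ℕ =>
    exists_polytope_nearby hU hK hKc hV hKV i.1 (Nat.one_div_pos_of_nat (α := ℝ) (n := i.2))
  have hlim : Tendsto L atTop (𝓝 K) := by
    refine le_nhds_hyperspace_iff.2 fun A ε hε => ?_
    obtain ⟨n, hn⟩ := exists_nat_one_div_lt hε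
    rw [eventually_map]
    filter_upwards [eventually_ge_atTop (({A} : Finset X), n)] with i hi
    have hle : 1 / ((i.2 : ℝ) + 1) < ε := (Nat.one_div_le_one_div hi.2).trans_lt hn
    obtain ⟨h1, h2⟩ := hL i A (hi.1 (Finset.mem_singleton_self A))
    refine ⟨fun σ hσ => ?_, fun τ hτ => ?_⟩
    · obtain ⟨τ, hτ, h⟩ := h1 σ hσ
      exact ⟨τ, hτ, h.trans hle⟩
    · obtain ⟨σ, hσ, h⟩ := h2 τ hτ
      exact ⟨σ, hσ, h.trans hle⟩
  exact hlim.frequently (Frequently.of_forall fun i => ⟨hLU i, hLV i⟩)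

end Approximation

/-! ### Countable tests, Baire category and the union over `U` -/

section Generic

variable {𝕜 : Type*} [RCLike 𝕜] {X : Type*} [AddCommGroup X] [Module 𝕜 X] [TopologicalSpace X]

/-- By regularity, closures of basic sets contained in larger basic sets suffice; the larger ones
are extended to ambient open sets. -/
theorem exists_countable_compact_open_pairs [TopologicalSpace.SeparableSpace X]
    {P : Set (WeakDual 𝕜 X)} (hP : IsCompact P) :
    ∃ 𝒮 : Set (Set (WeakDual 𝕜 X) × Set (WeakDual 𝕜 X)), 𝒮.Countable ∧
      (∀ q ∈ 𝒮, IsCompact q.1 ∧ IsOpen q.2 ∧ q.1 ⊆ q.2) ∧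
      ∀ σ ∈ P, ∀ V, IsOpen V → σ ∈ V → ∃ q ∈ 𝒮, σ ∈ q.1 ∧ P ∩ q.2 ⊆ V := by
  have := secondCountableTopology_of_isCompact hP
  have := isCompact_iff_compactSpace.1 hP
  have hB := TopologicalSpace.isBasis_countableBasis P
  have hext : ∀ b ∈ TopologicalSpace.countableBasis P,
      ∃ V : Set (WeakDual 𝕜 X), IsOpen V ∧ Subtype.val ⁻¹' V = b :=
    fun b hb => isOpen_induced_iff.1 (hB.isOpen hb)
  choose! e he heb using hext
  refine ⟨(fun p : Set P × Set P => (Subtype.val '' closure p.1, e p.2)) ''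
    {p | p ∈ TopologicalSpace.countableBasis P ×ˢ TopologicalSpace.countableBasis P ∧
      closure p.1 ⊆ p.2}, ?_, ?_, ?_⟩
  · exact (((TopologicalSpace.countable_countableBasis P).prod
      (TopologicalSpace.countable_countableBasis P)).mono fun p hp => hp.1).image _
  · rintro _ ⟨p, ⟨hp, hsub⟩, rfl⟩
    refine ⟨isClosed_closure.isCompact.image continuous_subtype_val, he _ hp.2, ?_⟩
    rintro _ ⟨σ, hσ, rfl⟩
    have h := hsub hσ
    rw [← heb _ hp.2] at h
    exact h
  · intro σ hσ V hV hσV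
    obtain ⟨b', hb', hσb', hb'V⟩ := hB.exists_subset_of_mem_open
      (show (⟨σ, hσ⟩ : P) ∈ Subtype.val ⁻¹' V from hσV) (hV.preimage continuous_subtype_val)
    obtain ⟨b, hb, hσb, hbb'⟩ := hB.exists_closure_subset ((hB.isOpen hb').mem_nhds hσb')
    refine ⟨_, ⟨(b, b'), ⟨⟨hb, hb'⟩, hbb'⟩, rfl⟩, ⟨⟨σ, hσ⟩, subset_closure hσb, rfl⟩, ?_⟩
    rintro τ ⟨hτ, hτe⟩
    have h : (⟨τ, hτ⟩ : P) ∈ Subtype.val ⁻¹' e b' := hτe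
    rw [heb b' hb'] at h
    exact hb'V h

/-- The members of `CUsub 𝕜 U` that miss `q.1` or have an extreme point in `q.2`. -/
def avoidOrExtreme (U : Set X) (q : Set (WeakDual 𝕜 X) × Set (WeakDual 𝕜 X)) :
    Set (CUsub 𝕜 U) :=
  {F | Disjoint F.1.carrier q.1 ∨ (F.1.carrier.extremePoints ℝ ∩ q.2).Nonempty}

theorem Dsub_eq_biInter_avoidOrExtreme {U : Set X}
    {𝒮 : Set (Set (WeakDual 𝕜 X) × Set (WeakDual 𝕜 X))}
    (h1 : ∀ q ∈ 𝒮, IsCompact q.1 ∧ IsOpen q.2 ∧ q.1 ⊆ q.2)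
    (h2 : ∀ σ ∈ WeakDual.polar 𝕜 U, ∀ V, IsOpen V → σ ∈ V →
      ∃ q ∈ 𝒮, σ ∈ q.1 ∧ WeakDual.polar 𝕜 U ∩ q.2 ⊆ V) :
    {F : CUsub 𝕜 U | F.1 ∈ Dsub 𝕜 U} = ⋂ q ∈ 𝒮, avoidOrExtreme U q := by
  ext F
  simp only [mem_iInter₂]
  constructor
  · intro hF q hq
    by_cases hd : Disjoint F.1.carrier q.1
    · exact Or.inl hd
    · obtain ⟨σ, hσ, hσq⟩ := not_disjoint_iff.1 hd
      have hcl : F.1.carrier = closure (F.1.carrier.extremePoints ℝ) := hF.2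
      have hσ' : σ ∈ closure (F.1.carrier.extremePoints ℝ) := hcl ▸ hσ
      obtain ⟨ρ, hρ, hρ'⟩ := mem_closure_iff.1 hσ' q.2 (h1 q hq).2.1 ((h1 q hq).2.2 hσq)
      exact Or.inr ⟨ρ, hρ', hρ⟩
  · intro hF
    refine ⟨F.2, Subset.antisymm (fun σ hσ => mem_closure_iff.2 fun V hV hσV => ?_)
      (closure_minimal extremePoints_subset F.1.2.2)⟩
    obtain ⟨q, hq, hσq, hqV⟩ := h2 σ (F.2.2 hσ) V hV hσV
    rcases hF q hq with hd | ⟨ρ, hρ, hρq⟩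
    · exact absurd hσq (disjoint_left.1 hd hσ)
    · exact ⟨ρ, hqV ⟨F.2.2 hρ.1, hρq⟩, hρ⟩

theorem CUsub_anti {U V : Set X} (h : U ⊆ V) : CUsub 𝕜 V ⊆ CUsub 𝕜 U :=
  fun _ hF => ⟨hF.1, fun _ hσ A hA => hF.2 hσ A (h hA)⟩

theorem InfiniteDimensionalPolar.mono {U V : Set X} (h : U ⊆ V)
    (hV : InfiniteDimensionalPolar 𝕜 V) : InfiniteDimensionalPolar 𝕜 U := by
  obtain ⟨σ, hσ, hb⟩ := hV
  exact ⟨σ, hσ, fun n => (hb n).mono (image_mono h)⟩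

theorem CUsub_subset_CU {U : Set X} (hU : U ∈ 𝓝 (0 : X)) : CUsub 𝕜 U ⊆ CU 𝕜 X :=
  fun _ hF => mem_iUnion₂.2 ⟨U, hU, hF⟩

theorem Dsub_subset_D {U : Set X} (hU : U ∈ 𝓝 (0 : X)) : Dsub 𝕜 U ⊆ D 𝕜 X :=
  fun _ hF => mem_iUnion₂.2 ⟨U, hU, hF⟩

variable [IsTopologicalAddGroup X] [ContinuousSMul 𝕜 X]

instance t2Space_CU : T2Space (CU 𝕜 X) := by
  refine t2Space_iff_disjoint_nhds.2 fun F G hFG => ?_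
  obtain ⟨U, hU, hF⟩ := mem_iUnion₂.1 F.2
  obtain ⟨V, hV, hG⟩ := mem_iUnion₂.1 G.2
  rw [nhds_subtype_eq_comap, nhds_subtype_eq_comap]
  exact disjoint_comap (disjoint_nhds_of_ne hU hV hF hG fun h => hFG (Subtype.ext h))

theorem t2Space_CUsub {U : Set X} (hU : U ∈ 𝓝 (0 : X)) : T2Space (CUsub 𝕜 U) :=
  T2Space.of_injective_continuous (inclusion_injective (CUsub_subset_CU hU))
    (continuous_inclusion (CUsub_subset_CU hU))

theorem isOpen_avoidOrExtreme {U : Set X} (hU : U ∈ 𝓝 (0 : X))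
    {q : Set (WeakDual 𝕜 X) × Set (WeakDual 𝕜 X)} (hq1 : IsCompact q.1) (hq2 : IsOpen q.2) :
    IsOpen (avoidOrExtreme U q) := by
  refine isOpen_iff_mem_nhds.2 fun F hF => ?_
  have hval := continuous_subtype_val.tendsto F
  rcases hF with hF | hF
  · filter_upwards [hval (eventually_disjoint F.2.1 (isCompact_carrier hU F.2) hq1 hF)] with L hL
    exact Or.inl hL
  · filter_upwards [hval (eventually_extremePoints_inter_nonempty hU F.2 hq2 hF)] with L hL
    exact Or.inr (hL L.2)

theorem dense_avoidOrExtreme {U : Set X} (hU : U ∈ 𝓝 (0 : X))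
    (hUi : InfiniteDimensionalPolar 𝕜 U) {q : Set (WeakDual 𝕜 X) × Set (WeakDual 𝕜 X)}
    (hq : IsOpen q.2) (hsub : q.1 ⊆ q.2) : Dense (avoidOrExtreme U q) := by
  intro F
  by_cases hd : Disjoint F.1.carrier q.1
  · exact subset_closure (Or.inl hd)
  obtain ⟨σ, hσ, hσq⟩ := not_disjoint_iff.1 hd
  have hfr := frequently_extremePoints_inter_nonempty hUi F.2 (isCompact_carrier hU F.2) hq
    ⟨σ, hσ, hsub hσq⟩
  rw [closure_subtype, mem_closure_iff_frequently]
  exact hfr.mono fun L hL => ⟨⟨L, hL.1⟩, Or.inr hL.2, rfl⟩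

variable [TopologicalSpace.SeparableSpace X]

theorem dense_and_isGδ_Dsub {U : Set X} (hU : U ∈ 𝓝 (0 : X))
    (hUi : InfiniteDimensionalPolar 𝕜 U) :
    Dense {F : CUsub 𝕜 U | F.1 ∈ Dsub 𝕜 U} ∧ IsGδ {F : CUsub 𝕜 U | F.1 ∈ Dsub 𝕜 U} := by
  obtain ⟨𝒮, h𝒮, h1, h2⟩ := exists_countable_compact_open_pairs (isCompact_polar (𝕜 := 𝕜) hU)
  rw [Dsub_eq_biInter_avoidOrExtreme h1 h2]
  have := isCompact_iff_compactSpace.1 (isCompact_CUsub (𝕜 := 𝕜) hU)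
  have := t2Space_CUsub (𝕜 := 𝕜) hU
  have hopen : ∀ q ∈ 𝒮, IsOpen (avoidOrExtreme U q) := fun q hq =>
    isOpen_avoidOrExtreme hU (h1 q hq).1 (h1 q hq).2.1
  exact ⟨dense_biInter_of_isOpen hopen h𝒮 fun q hq =>
    dense_avoidOrExtreme hU hUi (h1 q hq).2.1 (h1 q hq).2.2,
    IsGδ.biInter_of_isOpen h𝒮 hopen⟩

theorem dense_D {U₀ : Set X} (hU₀ : U₀ ∈ 𝓝 (0 : X)) (hi : InfiniteDimensionalPolar 𝕜 U₀) :
    Dense {F : CU 𝕜 X | F.1 ∈ D 𝕜 X} := by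
  intro F
  obtain ⟨U, hU, hF⟩ := mem_iUnion₂.1 F.2
  -- Shrinking the neighbourhood enlarges the polar, so `F` is kept and independence is inherited
  -- from `U₀`.
  have hV : U ∩ U₀ ∈ 𝓝 (0 : X) := inter_mem hU hU₀
  have hd := (dense_and_isGδ_Dsub hV (hi.mono inter_subset_right)).1
    ⟨F.1, CUsub_anti inter_subset_left hF⟩
  have hc := continuous_inclusion (CUsub_subset_CU (𝕜 := 𝕜) hV)
  refine closure_mono ?_ (image_closure_subset_closure_image hc (mem_image_of_mem _ hd))
  rintro _ ⟨G, hG, rfl⟩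
  exact Dsub_subset_D hV hG

theorem isGδ_D [FirstCountableTopology X] : IsGδ {F : CU 𝕜 X | F.1 ∈ D 𝕜 X} := by
  obtain ⟨U, hU⟩ := (𝓝 (0 : X)).exists_antitone_basis
  have hmem : ∀ n, U n ∈ 𝓝 (0 : X) := fun n => hU.1.mem_of_mem trivial
  choose 𝒮 h𝒮 h1 h2 using fun n =>
    exists_countable_compact_open_pairs (isCompact_polar (𝕜 := 𝕜) (hmem n))
  have heq : {F : CU 𝕜 X | F.1 ∈ D 𝕜 X} = ⋂ n, ⋂ q ∈ 𝒮 n,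
      (inclusion (CUsub_subset_CU (hmem n)) '' (avoidOrExtreme (U n) q)ᶜ)ᶜ := by
    ext F
    simp only [mem_iInter]
    constructor
    · rintro hF n q hq ⟨G, hG, rfl⟩
      obtain ⟨V, -, hV⟩ := mem_iUnion₂.1 hF
      -- Density of the extreme points does not depend on the neighbourhood, so it passes from `V`
      -- to `U n`.
      have hGD : G ∈ {F : CUsub 𝕜 (U n) | F.1 ∈ Dsub 𝕜 (U n)} := ⟨G.2, hV.2⟩
      rw [Dsub_eq_biInter_avoidOrExtreme (h1 n) (h2 n)] at hGD
      exact hG (mem_iInter₂.1 hGD q hq)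
    · intro hF
      obtain ⟨V, hV, hFV⟩ := mem_iUnion₂.1 F.2
      obtain ⟨n, -, hn⟩ := hU.1.mem_iff.1 hV
      let G : CUsub 𝕜 (U n) := ⟨F.1, CUsub_anti hn hFV⟩
      have hG : G ∈ ⋂ q ∈ 𝒮 n, avoidOrExtreme (U n) q := by
        refine mem_iInter₂.2 fun q hq => ?_
        by_contra h
        exact hF n q hq ⟨G, h, rfl⟩
      rw [← Dsub_eq_biInter_avoidOrExtreme (h1 n) (h2 n)] at hG
      exact Dsub_subset_D (hmem n) hG
  rw [heq]
  refine IsGδ.iInter fun n => IsGδ.biInter (h𝒮 n) fun q hq => IsOpen.isGδ ?_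
  have := isCompact_iff_compactSpace.1 (isCompact_CUsub (𝕜 := 𝕜) (hmem n))
  have hcl := (isOpen_avoidOrExtreme (hmem n) (h1 n q hq).1 (h1 n q hq).2.1).isClosed_compl
  exact (hcl.isCompact.image (continuous_inclusion _)).isClosed.isOpen_compl

end Generic

end WeakStarHyper

theorem mainTheorem1 {𝕜 : Type*} [RCLike 𝕜] {X : Type*} [AddCommGroup X] [Module 𝕜 X]
    [Module ℝ X] [IsScalarTower ℝ 𝕜 X] [TopologicalSpace X] [IsTopologicalAddGroup X]
    [ContinuousSMul 𝕜 X] [SeparatingDual 𝕜 X] [TopologicalSpace.SeparableSpace X] :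
    (WeakStarHyper.IsGateauxDifferentiabilitySpace X →
      ∀ U ∈ 𝓝 (0 : X), WeakStarHyper.InfiniteDimensionalPolar 𝕜 U →
        Dense {F : WeakStarHyper.CUsub 𝕜 U | F.1 ∈ WeakStarHyper.Dsub 𝕜 U} ∧
        IsGδ {F : WeakStarHyper.CUsub 𝕜 U | F.1 ∈ WeakStarHyper.Dsub 𝕜 U}) ∧
    (TopologicalSpace.IsCompletelyMetrizableSpace X →
      (∃ U ∈ 𝓝 (0 : X), WeakStarHyper.InfiniteDimensionalPolar 𝕜 U) →
        Dense {F : WeakStarHyper.CU 𝕜 X | F.1 ∈ WeakStarHyper.D 𝕜 X} ∧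
        IsGδ {F : WeakStarHyper.CU 𝕜 X | F.1 ∈ WeakStarHyper.D 𝕜 X}) := by
  refine ⟨fun _ U hU hi => WeakStarHyper.dense_and_isGδ_Dsub hU hi, ?_⟩
  rintro hX ⟨U, hU, hi⟩
  exact ⟨WeakStarHyper.dense_D hU hi, WeakStarHyper.isGδ_D⟩
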